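/- **Setting.** An instance of preemptive single-machine scheduling consists of finitely many jobs $j$ with release dates $r_j\ge 0$ and processing times $p_j>0$. A schedule specifies the amount $y_j(t)$ of processing that each job $j$ has received until time $t$: $y_j$ is nondecreasing, $y_j(t)=0$ for $t\le r_j$, $y_j\le p_j$, and $\sum_j (y_j(t)-y_j(s))\le t-s$ for all $s\le t$ (so the unit-speed machine may be shared among jobs). The completion time $C_j$ is the earliest $t$ with $y_j(t)=p_j$ ($C_j=\infty$ if there is none), and the cost of a schedule is its total flow time $\sum_j (C_j-r_j)$. Let $\mathrm{OPT}(I)$ denote the infimum of the total flow time over all schedules of the instance $I$. Let $\alpha\in[0,1]$. Job $j$ *emits its signal* at the earliest time $t\ge r_j$ with $y_j(t)\ge\alpha p_j$; at that moment $p_j$ is revealed. A deterministic $\alpha$-clairvoyant algorithm assigns to every instance a schedule such that, for every $t$, the schedule up to time $t$ is determined by the jobs released before $t$ (their names and release dates) and the signals emitted before $t$ (their times, and the names and processing times of the emitting jobs). A randomized $\alpha$-clairvoyant algorithm $A$ is a probability distribution over deterministic $\alpha$-clairvoyant algorithms. It is $c$-competitive if $\mathbb{E}[A(I)]\le c\cdot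 \mathrm{OPT}(I)$ for every instance $I$, where $A(I)$ is its total flow time on $I$; its competitive ratio is the infimum of all $c\in[0,\infty]$ for which it is $c$-competitive. **Theorem.** For every $\alpha\in(0,1)$, every randomized $\alpha$-clairvoyant algorithm for minimizing the total flow time on a single machine has competitive ratio at least $\frac32$. -/

import Mathlib

open MeasureTheory
open scoped ENNReal

namespace FlowTime

/-- A (finite) instance of single-machine scheduling with release dates. Jobs carry
natural-number names; the values of `release` and `proc` outside `jobs` are irrelevant. -/
structure Instance where
  jobs : Finset ℕ
  release : ℕ → ℝ
  proc : ℕ → ℝ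
  release_nonneg : ∀ j ∈ jobs, 0 ≤ release j
  proc_pos : ∀ j ∈ jobs, 0 < proc j

/-- A feasible preemptive schedule of `I` on one unit-speed machine. It is given by the amounts
`y j t` of processing that job `j` has received until time `t`. The machine may be shared between
several jobs at the same time, at total rate at most one; running one job at a time is
the special case in which at each time one rate is one and all others vanish. -/
structure IsSchedule (I : Instance) (y : ℕ → ℝ → ℝ) : Prop where
  mono : ∀ j, Monotone (y j)
  not_job : ∀ j, j ∉ I.jobs → ∀ t, y j t = 0
  before_release : ∀ j ∈ I.jobs, ∀ t, t ≤ I.release j → y j t = 0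
  le_proc : ∀ j ∈ I.jobs, ∀ t, y j t ≤ I.proc j
  speed : ∀ s t, s ≤ t → ∑ j ∈ I.jobs, (y j t - y j s) ≤ t - s

/-- Completion time of job `j`: the earliest time at which it has been fully processed
(`⊤` if there is none). -/
noncomputable def completionTime (I : Instance) (y : ℕ → ℝ → ℝ) (j : ℕ) : ℝ≥0∞ :=
  ⨅ (t : ℝ) (_ : I.proc j ≤ y j t), ENNReal.ofReal t

/-- Total flow time: the sum over all jobs of completion time minus release date. -/
noncomputable def totalFlow (I : Instance) (y : ℕ → ℝ → ℝ) : ℝ≥0∞ :=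
  ∑ j ∈ I.jobs, (completionTime I y j - ENNReal.ofReal (I.release j))

/-- The offline optimum. -/
noncomputable def opt (I : Instance) : ℝ≥0∞ :=
  ⨅ (y : ℕ → ℝ → ℝ) (_ : IsSchedule I y), totalFlow I y

/-- What is known about arrivals at time `u`: names and release dates of the jobs released
until then. -/
def arrivals (I : Instance) (u : ℝ) : Set (ℕ × ℝ) :=
  {x | ∃ j ∈ I.jobs, I.release j ≤ u ∧ x = (j, I.release j)}

/-- What the signals have revealed by time `u`: the jobs that have emitted their signal, which
happens once an `α`-fraction of the job is processed, together with their processing times. -/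
def signals (α : ℝ) (I : Instance) (y : ℕ → ℝ → ℝ) (u : ℝ) : Set (ℕ × ℝ) :=
  {x | ∃ j ∈ I.jobs, I.release j ≤ u ∧ α * I.proc j ≤ y j u ∧ x = (j, I.proc j)}

/-- A deterministic `α`-clairvoyant online algorithm: it produces a feasible schedule for each
instance, and what it does until time `t` is determined by the arrivals and signals that it
observes before time `t`. (For `α ≤ 1` a job emits no later than it completes, so completions
are known from the signals and the algorithm's own schedule.) -/
structure DetAlgorithm (α : ℝ) where
  sched : Instance → ℕ → ℝ → ℝ
  feasible : ∀ I, IsSchedule I (sched I)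
  online : ∀ (I I' : Instance) (t : ℝ),
    (∀ u < t, arrivals I u = arrivals I' u ∧
      signals α I (sched I) u = signals α I' (sched I') u) →
    ∀ j, ∀ u ≤ t, sched I j u = sched I' j u

/-- A randomized `α`-clairvoyant online algorithm: a random deterministic one. -/
structure RandAlgorithm (α : ℝ) where
  Ω : Type*
  [measurableSpace : MeasurableSpace Ω]
  μ : Measure Ω
  [isProbabilityMeasure : IsProbabilityMeasure μ]
  alg : Ω → DetAlgorithm α
  measurable_sched : ∀ (I : Instance) (j : ℕ) (t : ℝ), Measurable fun ω => (alg ω).sched I j t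

attribute [instance] RandAlgorithm.measurableSpace RandAlgorithm.isProbabilityMeasure

/-- Expected total flow time on a fixed instance. -/
noncomputable def RandAlgorithm.expectedFlow {α : ℝ} (A : RandAlgorithm α) (I : Instance) :
    ℝ≥0∞ :=
  ∫⁻ ω, totalFlow I ((A.alg ω).sched I) ∂A.μ

/-- `A` is `c`-competitive: its expected total flow time is at most `c` times the optimum, on
every instance. -/
def RandAlgorithm.IsCompetitive {α : ℝ} (A : RandAlgorithm α) (c : ℝ≥0∞) : Prop :=
  ∀ I : Instance, A.expectedFlow I ≤ c * opt I

/-- The competitive ratio: the infimum of all `c` such that `A` is `c`-competitive. -/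
noncomputable def RandAlgorithm.competitiveRatio {α : ℝ} (A : RandAlgorithm α) : ℝ≥0∞ :=
  sInf {c | A.IsCompetitive c}

end FlowTime

/-!
Jobs are released in `k` pairs, on geometrically decreasing time scales. Each pair consists of a
long job of size one and of a short job that fits exactly before the next pair, and for some time
after their release neither of them can have emitted its signal. Hence for each pair, one of the two
assignments of the sizes makes the algorithm give at most half of its speed to the short job during
that time, and then the short job cannot be finished before the next pairs arrive. The pairs are
followed by a long stream of tiny jobs, which keep the machine busy; processing anything else during
the stream delays a number of tiny jobs that grows as their size decreases. So the `k` long jobs and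
the delayed short jobs, half of the short jobs on average over all assignments, wait for the whole
stream, while only the `k` long jobs do so in a good schedule. This gives the ratio
`(k + k / 2) / k`, up to lower order terms.
-/

namespace FlowTime

open Filter Set Topology

variable {α : ℝ}

/-! ### Schedules -/

namespace IsSchedule

variable {I : Instance} {y : ℕ → ℝ → ℝ} {j : ℕ} {s t x : ℝ}

theorem eq_zero_of_nonpos (hy : IsSchedule I y) (j : ℕ) (ht : t ≤ 0) : y j t = 0 := by
  by_cases hj : j ∈ I.jobs
  · exact hy.before_release j hj t (ht.trans (I.release_nonneg j hj))
  · exact hy.not_job j hj t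

theorem nonneg (hy : IsSchedule I y) (j : ℕ) (t : ℝ) : 0 ≤ y j t :=
  (hy.eq_zero_of_nonpos j (min_le_right t 0)).ge.trans (hy.mono j (min_le_left t 0))

theorem sum_sub_le_of_subset (hy : IsSchedule I y) {J : Finset ℕ} (hJ : J ⊆ I.jobs)
    (hst : s ≤ t) : ∑ j ∈ J, (y j t - y j s) ≤ t - s :=
  (Finset.sum_le_sum_of_subset_of_nonneg hJ fun j _ _ => sub_nonneg.2 (hy.mono j hst)).trans
    (hy.speed s t hst)

theorem sub_le (hy : IsSchedule I y) (hj : j ∈ I.jobs) (hst : s ≤ t) : y j t - y j s ≤ t - s := by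
  simpa using hy.sum_sub_le_of_subset (Finset.singleton_subset_iff.2 hj) hst

theorem lt_of_lt_release_add (hy : IsSchedule I y) (hj : j ∈ I.jobs) (hx : 0 < x)
    (ht : t < I.release j + x) : y j t < x := by
  have hrelease := hy.before_release j hj
  rcases le_total t (I.release j) with h | h
  · rwa [hrelease t h]
  · linarith [hy.sub_le hj h, hrelease _ le_rfl]

theorem lipschitzWith_one (hy : IsSchedule I y) (hj : j ∈ I.jobs) : LipschitzWith 1 (y j) := by
  refine LipschitzWith.of_le_add fun s t => ?_
  rcases le_total s t with h | h
  · exact (hy.mono j h).trans (le_add_of_nonneg_right dist_nonneg)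
  · rw [Real.dist_eq, abs_of_nonneg (sub_nonneg.2 h)]
    linarith [hy.sub_le hj h]

theorem eventually_nhdsGT_le_iff (hy : IsSchedule I y) (hj : j ∈ I.jobs) (c t : ℝ) :
    ∀ᶠ u in 𝓝[>] t, (c ≤ y j u ↔ c ≤ y j t) := by
  rcases le_or_gt c (y j t) with h | h
  · filter_upwards [self_mem_nhdsWithin] with u hu
    exact iff_of_true (h.trans (hy.mono j (mem_Ioi.1 hu).le)) h
  · have hlt : ∀ᶠ u in 𝓝 t, y j u < c :=
      ((hy.lipschitzWith_one hj).continuous.tendsto t).eventually_lt_const h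
    filter_upwards [nhdsWithin_le_nhds hlt] with u hu
    exact iff_of_false hu.not_ge h.not_ge

end IsSchedule

/-- The contribution of the job `j` to the total flow time. -/
noncomputable def flowTime (I : Instance) (y : ℕ → ℝ → ℝ) (j : ℕ) : ℝ≥0∞ :=
  completionTime I y j - ENNReal.ofReal (I.release j)

section CompletionTime

variable {I : Instance} {y : ℕ → ℝ → ℝ} {j : ℕ} {t d : ℝ}

theorem ofReal_le_completionTime (hy : Monotone (y j)) (ht : y j t < I.proc j) :
    ENNReal.ofReal t ≤ completionTime I y j :=
  le_iInf₂ fun _ hs => ENNReal.ofReal_le_ofReal (hy.reflect_lt (ht.trans_le hs)).le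

theorem ofReal_le_flowTime (hj : j ∈ I.jobs) (hy : Monotone (y j)) (ht : y j t < I.proc j) :
    ENNReal.ofReal (t - I.release j) ≤ flowTime I y j := by
  rw [ENNReal.ofReal_sub _ (I.release_nonneg j hj)]
  exact tsub_le_tsub_right (ofReal_le_completionTime hy ht) _

theorem flowTime_le_ofReal (hj : j ∈ I.jobs) (ht : I.proc j ≤ y j t) :
    flowTime I y j ≤ ENNReal.ofReal (t - I.release j) := by
  rw [ENNReal.ofReal_sub _ (I.release_nonneg j hj)]
  exact tsub_le_tsub_right (iInf₂_le t ht) _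

theorem IsSchedule.ofReal_mul_unprocessed_fraction_le_flowTime (hy : IsSchedule I y)
    (hj : j ∈ I.jobs) (hd : 0 ≤ d) (ht : I.release j + d ≤ t) :
    ENNReal.ofReal (d * ((I.proc j - y j t) / I.proc j)) ≤ flowTime I y j := by
  rcases (hy.le_proc j hj t).eq_or_lt with h | h
  · simp [h]
  · have hfraction : (I.proc j - y j t) / I.proc j ≤ 1 :=
      (div_le_one (I.proc_pos j hj)).2 (sub_le_self _ (hy.nonneg j t))
    refine (ENNReal.ofReal_le_ofReal ?_).trans (ofReal_le_flowTime hj (hy.mono j) h)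
    exact (mul_le_of_le_one_right hd hfraction).trans (by linarith)

theorem completionTime_lt_iff_exists_rat (hy : Monotone (y j)) {a : ℝ≥0∞} :
    completionTime I y j < a ↔ ∃ q : ℚ, I.proc j ≤ y j q ∧ ENNReal.ofReal q < a := by
  simp only [completionTime, iInf_lt_iff, exists_prop]
  refine ⟨fun ⟨t, ht, hta⟩ => ?_, fun ⟨q, hq⟩ => ⟨q, hq⟩⟩
  obtain ⟨q, -, htq, hqa⟩ := ENNReal.lt_iff_exists_rat_btwn.1 hta
  have htq' : t < q := (ENNReal.ofReal_lt_ofReal_iff'.1 htq).1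
  exact ⟨q, ht.trans (hy htq'.le), hqa⟩

end CompletionTime

namespace RandAlgorithm

variable (A : RandAlgorithm α)

theorem measurable_completionTime (I : Instance) (j : ℕ) :
    Measurable fun ω => completionTime I ((A.alg ω).sched I) j := by
  refine measurable_of_Iio fun a => ?_
  have hpreimage : (fun ω => completionTime I ((A.alg ω).sched I) j) ⁻¹' Iio a =
      ⋃ (q : ℚ) (_ : ENNReal.ofReal q < a), {ω | I.proc j ≤ (A.alg ω).sched I j q} := by
    ext ω
    simp only [mem_preimage, mem_Iio, mem_iUnion, mem_ofPred_eq, exists_prop, and_comm,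
      completionTime_lt_iff_exists_rat (((A.alg ω).feasible I).mono j)]
  rw [hpreimage]
  exact .iUnion fun q => .iUnion fun _ =>
    measurableSet_le measurable_const (A.measurable_sched I j q)

theorem measurable_totalFlow (I : Instance) :
    Measurable fun ω => totalFlow I ((A.alg ω).sched I) :=
  Finset.measurable_sum _ fun j _ => (A.measurable_completionTime I j).sub_const _

variable {A}

-- The easy half of Yao's principle.
theorem IsCompetitive.le_mul_sum_opt {c : ℝ≥0∞} (hA : A.IsCompetitive c) {ι : Type*}
    (s : Finset ι) (F : ι → Instance) {a : ℝ≥0∞}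
    (ha : ∀ D : DetAlgorithm α, a ≤ ∑ i ∈ s, totalFlow (F i) (D.sched (F i))) :
    a ≤ c * ∑ i ∈ s, opt (F i) :=
  calc a = ∫⁻ _, a ∂A.μ := by simp
    _ ≤ ∫⁻ ω, ∑ i ∈ s, totalFlow (F i) ((A.alg ω).sched (F i)) ∂A.μ :=
      lintegral_mono fun ω => ha (A.alg ω)
    _ = ∑ i ∈ s, A.expectedFlow (F i) :=
      lintegral_finsetSum _ fun i _ => A.measurable_totalFlow (F i)
    _ ≤ ∑ i ∈ s, c * opt (F i) := Finset.sum_le_sum fun i _ => hA (F i)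
    _ = c * ∑ i ∈ s, opt (F i) := Finset.mul_sum .. |>.symm

end RandAlgorithm

/-! ### Indistinguishable instances -/

theorem forall_lt_of_eventually_nhdsGT {X : Type*} [ConditionallyCompleteLinearOrder X]
    [TopologicalSpace X] [OrderTopology X] [DenselyOrdered X] {p : X → Prop} {a b : X}
    (hstart : ∀ u < a, p u)
    (hstep : ∀ t ∈ Ico a b, (∀ u < t, p u) → p t ∧ ∀ᶠ u in 𝓝[>] t, p u) :
    ∀ u < b, p u := by
  rcases le_total b a with hba | hab
  · exact fun u hu => hstart u (hu.trans_le hba)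
  -- The set of all `t` such that `p` holds before `t` is closed, whatever `p` is.
  have hclosed : IsClosed {t | ∀ u < t, p u} := by
    simp only [ofPred_forall]
    refine isClosed_iInter fun u => ?_
    by_cases hu : p u
    · simp [hu]
    · simp only [hu, imp_false, not_lt]
      exact isClosed_Iic
  refine (hclosed.inter isClosed_Icc).Icc_subset_of_forall_mem_nhdsWithin hstart ?_
    (right_mem_Icc.2 hab)
  rintro t ⟨hbefore, htab⟩
  obtain ⟨ht, hafter⟩ := hstep t htab hbefore
  obtain ⟨t', ht', hIoo⟩ := (mem_nhdsGT_iff_exists_Ioo_subset' htab.2).1 hafter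
  filter_upwards [Ioo_mem_nhdsGT ht'] with v hv u huv
  rcases lt_trichotomy u t with h | rfl | h
  · exact hbefore u h
  · exact ht
  · exact hIoo ⟨h, huv.trans hv.2⟩

theorem signals_eq_of_emission_iff {I I' : Instance} {y y' : ℕ → ℝ → ℝ} {u : ℝ}
    (hjobs : I.jobs = I'.jobs) (hrelease : I.release = I'.release)
    (hemit : ∀ j ∈ I.jobs, (α * I.proc j ≤ y j u ↔ α * I'.proc j ≤ y' j u) ∧
      (α * I.proc j ≤ y j u → I.proc j = I'.proc j)) :
    signals α I y u = signals α I' y' u := by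
  ext z
  simp only [signals, mem_ofPred_eq, ← hjobs, ← hrelease]
  refine exists_congr fun j => and_congr_right fun hj => and_congr_right fun _ => ?_
  obtain ⟨hiff, hproc⟩ := hemit j hj
  rw [← hiff]
  exact and_congr_right fun h => by rw [hproc h]

theorem DetAlgorithm.sched_eq_of_no_signal (D : DetAlgorithm α) {I I' : Instance} {τ : ℝ}
    (hjobs : I.jobs = I'.jobs) (hrelease : I.release = I'.release)
    (hquiet : ∀ j ∈ I.jobs, I.proc j ≠ I'.proc j → ∀ u < τ,
      D.sched I j u < α * I.proc j ∧ D.sched I' j u < α * I'.proc j) :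
    ∀ j, ∀ u ≤ τ, D.sched I j u = D.sched I' j u := by
  have hy := D.feasible I
  have hy' := D.feasible I'
  have hsignals : ∀ u < τ, (∀ j ∈ I.jobs,
      (α * I.proc j ≤ D.sched I j u ↔ α * I.proc j ≤ D.sched I' j u)) →
      signals α I (D.sched I) u = signals α I' (D.sched I') u := by
    refine fun u hu hiff => signals_eq_of_emission_iff hjobs hrelease fun j hj => ?_
    by_cases hproc : I.proc j = I'.proc j
    · exact ⟨hproc ▸ hiff j hj, fun _ => hproc⟩
    · obtain ⟨hlt, hlt'⟩ := hquiet j hj hproc u hu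
      exact ⟨iff_of_false hlt.not_ge hlt'.not_ge, fun h => absurd h hlt.not_ge⟩
  have hagree : ∀ t, (∀ u < t, signals α I (D.sched I) u = signals α I' (D.sched I') u) →
      ∀ j, ∀ u ≤ t, D.sched I j u = D.sched I' j u := fun t ht =>
    D.online I I' t fun u hu => ⟨by simp only [arrivals, hjobs, hrelease], ht u hu⟩
  refine hagree τ (forall_lt_of_eventually_nhdsGT (a := min 0 τ) (fun u hu => ?_)
    fun t ht hbefore => ⟨?_, ?_⟩)
  · obtain ⟨hu0, huτ⟩ := lt_min_iff.1 hu
    refine hsignals u huτ fun j _ => ?_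
    rw [hy.eq_zero_of_nonpos j hu0.le, hy'.eq_zero_of_nonpos j hu0.le]
  · exact hsignals t ht.2 fun j _ => by rw [hagree t hbefore j t le_rfl]
  · have hiff : ∀ᶠ u in 𝓝[>] t, ∀ j ∈ I.jobs,
        (α * I.proc j ≤ D.sched I j u ↔ α * I.proc j ≤ D.sched I' j u) := by
      refine (eventually_all_finset _).2 fun j hj => ?_
      filter_upwards [hy.eventually_nhdsGT_le_iff hj (α * I.proc j) t,
        hy'.eventually_nhdsGT_le_iff (hjobs ▸ hj) (α * I.proc j) t] with u hu hu'
      rw [hu, hu', hagree t hbefore j t le_rfl]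
    filter_upwards [hiff, Ioo_mem_nhdsGT ht.2] with u hu huτ using hsignals u huτ.2 hu

/-! ### Nonpreemptive schedules -/

/-- The processing amounts that result from running each job `j` of `I`, and no other, at unit
speed during the set of times `B j`. -/
noncomputable def processingDuring (I : Instance) (B : ℕ → Set ℝ) (j : ℕ) (t : ℝ) : ℝ :=
  if j ∈ I.jobs then volume.real (B j ∩ Iic t) else 0

section Nonpreemptive

variable {I : Instance}

theorem processingDuring_sub {B : ℕ → Set ℝ} {j : ℕ} (hj : j ∈ I.jobs)
    (hB : volume (B j) ≠ ∞) {s t : ℝ} (hst : s ≤ t) :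
    processingDuring I B j t - processingDuring I B j s = volume.real (B j ∩ Ioc s t) := by
  have hdiff : B j ∩ Ioc s t = (B j ∩ Iic t) \ Iic s := by
    rw [inter_sdiff_assoc, Iic_sdiff_Iic]
  have hinter : B j ∩ Iic t ∩ Iic s = B j ∩ Iic s := by
    rw [inter_assoc, Iic_inter_Iic, min_eq_right hst]
  simp only [processingDuring, if_pos hj]
  rw [hdiff, ← measureReal_inter_add_sdiff (s := B j ∩ Iic t) measurableSet_Iic
    (measure_ne_top_of_subset inter_subset_left hB), hinter, add_sub_cancel_left]

theorem isSchedule_processingDuring {B : ℕ → Set ℝ} (hmeas : ∀ j ∈ I.jobs, MeasurableSet (B j))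
    (hdisj : (I.jobs : Set ℕ).PairwiseDisjoint B)
    (hrelease : ∀ j ∈ I.jobs, B j ⊆ Ioi (I.release j))
    (hvol : ∀ j ∈ I.jobs, volume (B j) ≤ ENNReal.ofReal (I.proc j)) :
    IsSchedule I (processingDuring I B) := by
  have hfinite : ∀ j ∈ I.jobs, volume (B j) ≠ ∞ := fun j hj =>
    ne_top_of_le_ne_top ENNReal.ofReal_ne_top (hvol j hj)
  refine ⟨fun j s t hst => ?_, fun j hj t => if_neg hj, fun j hj t ht => ?_, fun j hj t => ?_,
    fun s t hst => ?_⟩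
  · by_cases hj : j ∈ I.jobs
    · rw [← sub_nonneg, processingDuring_sub hj (hfinite j hj) hst]
      exact measureReal_nonneg
    · simp only [processingDuring, if_neg hj, le_rfl]
  · have hempty : B j ∩ Iic t = ∅ := disjoint_iff_inter_eq_empty.1 <|
      (Iic_disjoint_Ioi ht).symm.mono_left (hrelease j hj)
    simp only [processingDuring, if_pos hj, hempty, measureReal_empty]
  · rw [processingDuring, if_pos hj]
    exact ENNReal.toReal_le_of_le_ofReal (I.proc_pos j hj).le
      ((measure_mono inter_subset_left).trans (hvol j hj))
  · calc ∑ j ∈ I.jobs, (processingDuring I B j t - processingDuring I B j s)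
        = ∑ j ∈ I.jobs, volume.real (B j ∩ Ioc s t) :=
          Finset.sum_congr rfl fun j hj => processingDuring_sub hj (hfinite j hj) hst
      _ = volume.real (⋃ j ∈ I.jobs, B j ∩ Ioc s t) :=
          (measureReal_biUnion_finset (hdisj.mono fun j => inter_subset_left)
            (fun j hj => (hmeas j hj).inter measurableSet_Ioc)
            fun j hj => measure_ne_top_of_subset inter_subset_left (hfinite j hj)).symm
      _ ≤ volume.real (Ioc s t) :=
          measureReal_mono (iUnion₂_subset fun j _ => inter_subset_right) measure_Ioc_lt_top.ne
      _ = t - s := by rw [Real.volume_real_Ioc_of_le hst]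

theorem opt_le_of_disjoint_intervals (b : ℕ → ℝ) (hb : ∀ j ∈ I.jobs, I.release j ≤ b j)
    (hdisj : (I.jobs : Set ℕ).PairwiseDisjoint fun j => Ioc (b j) (b j + I.proc j)) :
    opt I ≤ ENNReal.ofReal (∑ j ∈ I.jobs, (b j + I.proc j - I.release j)) := by
  set B : ℕ → Set ℝ := fun j => Ioc (b j) (b j + I.proc j)
  have hschedule : IsSchedule I (processingDuring I B) :=
    isSchedule_processingDuring (fun j _ => measurableSet_Ioc) hdisj
      (fun j hj t ht => (hb j hj).trans_lt ht.1)
      fun j _ => by rw [Real.volume_Ioc, add_sub_cancel_left]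
  have hfinished : ∀ j ∈ I.jobs, I.proc j ≤ processingDuring I B j (b j + I.proc j) :=
    fun j hj => by
      rw [processingDuring, if_pos hj, inter_eq_left.2 fun t ht => ht.2,
        Real.volume_real_Ioc_of_le (le_add_of_nonneg_right (I.proc_pos j hj).le),
        add_sub_cancel_left]
  calc opt I ≤ ∑ j ∈ I.jobs, flowTime I (processingDuring I B) j := iInf₂_le _ hschedule
    _ ≤ ∑ j ∈ I.jobs, ENNReal.ofReal (b j + I.proc j - I.release j) :=
      Finset.sum_le_sum fun j hj => flowTime_le_ofReal hj (hfinished j hj)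
    _ = ENNReal.ofReal (∑ j ∈ I.jobs, (b j + I.proc j - I.release j)) :=
      (ENNReal.ofReal_sum_of_nonneg fun j hj => by linarith [hb j hj, I.proc_pos j hj]).symm

end Nonpreemptive

/-! ### Instances indexed by a finite type -/

namespace Instance

open Encodable

variable {ι : Type*} [Fintype ι] [Encodable ι] {r p : ι → ℝ} (hr : ∀ x, 0 ≤ r x)
  (hp : ∀ x, 0 < p x)

/-- The instance with one job for each element of a finite type, named by its code, with the given
release dates and processing times. -/
noncomputable def ofIndexed : Instance where
  jobs := Finset.univ.map (encode' ι)
  release := Function.extend encode r 0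
  proc := Function.extend encode p 0
  release_nonneg := by simp [encode', encode_injective.extend_apply, hr]
  proc_pos := by simp [encode', encode_injective.extend_apply, hp]

@[simp]
theorem mem_jobs_ofIndexed {j : ℕ} : j ∈ (ofIndexed hr hp).jobs ↔ ∃ x : ι, encode x = j := by
  simp [ofIndexed, encode']

@[simp]
theorem release_ofIndexed (x : ι) : (ofIndexed hr hp).release (encode x) = r x :=
  encode_injective.extend_apply r 0 x

@[simp]
theorem proc_ofIndexed (x : ι) : (ofIndexed hr hp).proc (encode x) = p x :=
  encode_injective.extend_apply p 0 x

theorem sum_jobs_ofIndexed {M : Type*} [AddCommMonoid M] (f : ℕ → M) :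
    ∑ j ∈ (ofIndexed hr hp).jobs, f j = ∑ x : ι, f (encode x) :=
  Finset.sum_map ..

theorem opt_ofIndexed_le (b : ι → ℝ) (hb : ∀ x, r x ≤ b x)
    (hdisj : Pairwise (Function.onFun Disjoint fun x => Ioc (b x) (b x + p x))) :
    opt (ofIndexed hr hp) ≤ ENNReal.ofReal (∑ x, (b x + p x - r x)) := by
  have hb' : ∀ x, Function.extend encode b 0 (encode x) = b x := encode_injective.extend_apply b 0
  refine (opt_le_of_disjoint_intervals (Function.extend encode b 0) ?_ ?_).trans_eq ?_
  · simpa [hb'] using hb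
  · intro i hi j hj hij
    obtain ⟨x, rfl⟩ := (mem_jobs_ofIndexed hr hp).1 hi
    obtain ⟨x', rfl⟩ := (mem_jobs_ofIndexed hr hp).1 hj
    simpa [Function.onFun, hb'] using hdisj fun h : x = x' => hij (congrArg encode h)
  · simp only [sum_jobs_ofIndexed, hb', release_ofIndexed, proc_ofIndexed]

end Instance

/-! ### The hard instances -/

theorem sum_bool_eq_add_not {M : Type*} [AddCommMonoid M] (f : Bool → M) (b : Bool) :
    ∑ c, f c = f b + f (!b) := by
  cases b <;> simp [add_comm]

/-- Parameters of the hard instances: `k` pairs of jobs on the geometrically decreasing scales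
`β ^ i`, followed by a stream of `N` jobs of size `ε`. -/
structure HardParams where
  β : ℝ
  ε : ℝ
  k : ℕ
  N : ℕ
  β_pos : 0 < β
  three_mul_β_le_one : 3 * β ≤ 1
  ε_pos : 0 < ε

namespace HardParams

variable (P : HardParams) (σ : Fin P.k → Bool)

/-- The release date of the pair `i`; for `i = k`, the beginning of the stream. -/
noncomputable def pairTime (i : ℕ) : ℝ := 1 - P.β ^ i

/-- The release date of the stream job `m`; for `m = N`, the end of the stream. -/
noncomputable def streamTime (m : ℕ) : ℝ := P.pairTime P.k + m * P.ε

/-- The total size of the stream jobs, which is also the time within which they arrive. -/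
noncomputable def streamLength : ℝ := P.N * P.ε

/-- The size of the short job of the pair `i`, which fits exactly between the releases of the pairs
`i` and `i + 1`. -/
noncomputable def shortSize (i : ℕ) : ℝ := P.β ^ i - P.β ^ (i + 1)

/-- The jobs of a hard instance: `k` pairs, whose elements are told apart by a Boolean, and `N`
stream jobs. -/
abbrev Job : Type := (Fin P.k × Bool) ⊕ Fin P.N

/-- Release dates of the hard instances; the jobs of a pair arrive together. -/
noncomputable def release : P.Job → ℝ :=
  Sum.elim (fun x => P.pairTime x.1) fun m => P.streamTime m

/-- Processing times of the hard instances; `σ` selects the short job of each pair, and the other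
job of the pair has size one. -/
noncomputable def proc : P.Job → ℝ :=
  Sum.elim (fun x => if x.2 = σ x.1 then P.shortSize x.1 else 1) fun _ => P.ε

theorem β_lt_one : P.β < 1 := by linarith [P.β_pos, P.three_mul_β_le_one]

theorem β_pow_pos (i : ℕ) : 0 < P.β ^ i := pow_pos P.β_pos i

theorem β_pow_le_one (i : ℕ) : P.β ^ i ≤ 1 := pow_le_one₀ P.β_pos.le P.β_lt_one.le

theorem three_mul_β_pow_succ_le (i : ℕ) : 3 * P.β ^ (i + 1) ≤ P.β ^ i := by
  have := mul_le_mul_of_nonneg_right P.three_mul_β_le_one (P.β_pow_pos i).le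
  linarith [pow_succ' P.β i]

theorem one_sub_pairTime (i : ℕ) : 1 - P.pairTime i = P.β ^ i := sub_sub_cancel _ _

theorem pairTime_nonneg (i : ℕ) : 0 ≤ P.pairTime i := sub_nonneg.2 (P.β_pow_le_one i)

theorem pairTime_le_one (i : ℕ) : P.pairTime i ≤ 1 := sub_le_self 1 (P.β_pow_pos i).le

theorem pairTime_mono : Monotone P.pairTime :=
  fun _ _ h => sub_le_sub_left (pow_le_pow_of_le_one P.β_pos.le P.β_lt_one.le h) 1

theorem pairTime_add_shortSize (i : ℕ) : P.pairTime i + P.shortSize i = P.pairTime (i + 1) := by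
  simp only [pairTime, shortSize]
  ring

theorem streamTime_mono : Monotone P.streamTime := fun _ _ h =>
  add_le_add_right (mul_le_mul_of_nonneg_right (Nat.cast_le.2 h) P.ε_pos.le) _

theorem streamTime_add_ε (m : ℕ) : P.streamTime m + P.ε = P.streamTime (m + 1) := by
  simp only [streamTime, Nat.cast_add_one]
  ring

theorem pairTime_le_streamTime {i : ℕ} (hi : i ≤ P.k) (m : ℕ) : P.pairTime i ≤ P.streamTime m :=
  (P.pairTime_mono hi).trans (le_add_of_nonneg_right (mul_nonneg m.cast_nonneg P.ε_pos.le))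

theorem streamLength_nonneg : 0 ≤ P.streamLength := mul_nonneg P.N.cast_nonneg P.ε_pos.le

theorem streamTime_N : P.streamTime P.N = P.pairTime P.k + P.streamLength := rfl

theorem shortSize_pos (i : ℕ) : 0 < P.shortSize i := by
  rw [shortSize]
  linarith [P.three_mul_β_pow_succ_le i, P.β_pow_pos (i + 1)]

theorem shortSize_le_one (i : ℕ) : P.shortSize i ≤ 1 := by
  rw [shortSize]
  linarith [P.β_pow_le_one i, P.β_pow_pos (i + 1)]

theorem release_nonneg (x : P.Job) : 0 ≤ P.release x := by
  rcases x with x | m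
  · exact P.pairTime_nonneg x.1
  · exact (P.pairTime_nonneg _).trans (P.pairTime_le_streamTime le_rfl m)

theorem proc_pos (x : P.Job) : 0 < P.proc σ x := by
  rcases x with x | _
  · simp only [proc, Sum.elim_inl]
    split_ifs
    exacts [P.shortSize_pos _, one_pos]
  · exact P.ε_pos

/-- The hard instance in which `σ` selects the short job of each pair. -/
noncomputable def inst : Instance := Instance.ofIndexed P.release_nonneg (P.proc_pos σ)

/-! ### The optimum of the hard instances -/

/-- Starting times of the jobs in a good schedule: the short jobs and the stream jobs run as soon
as they arrive, and the long jobs after the end of the stream. -/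
noncomputable def start : P.Job → ℝ :=
  Sum.elim (fun x => if x.2 = σ x.1 then P.pairTime x.1 else P.streamTime P.N + (x.1 : ℕ))
    fun m => P.streamTime m

theorem release_le_start (x : P.Job) : P.release x ≤ P.start σ x := by
  rcases x with ⟨i, b⟩ | m
  · simp only [release, start, Sum.elim_inl]
    split_ifs
    · exact le_rfl
    · exact (P.pairTime_le_streamTime i.2.le _).trans (le_add_of_nonneg_right (Nat.cast_nonneg _))
  · exact le_rfl

theorem start_add_proc_le_start_or {x y : P.Job} (hxy : x ≠ y) :
    P.start σ x + P.proc σ x ≤ P.start σ y ∨ P.start σ y + P.proc σ y ≤ P.start σ x := by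
  have hshort {i j : ℕ} (hij : i < j) : P.pairTime i + P.shortSize i ≤ P.pairTime j :=
    (P.pairTime_add_shortSize i).trans_le (P.pairTime_mono hij)
  have hstream {m n : ℕ} (hmn : m < n) : P.streamTime m + P.ε ≤ P.streamTime n :=
    (P.streamTime_add_ε m).trans_le (P.streamTime_mono hmn)
  have hlong {i j : ℕ} (hij : i < j) : P.streamTime P.N + i + 1 ≤ P.streamTime P.N + j := by
    rw [add_assoc]
    exact add_le_add_right (by exact_mod_cast hij) _
  have hshort_stream (i : Fin P.k) (m : ℕ) : P.pairTime i + P.shortSize i ≤ P.streamTime m :=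
    (P.pairTime_add_shortSize i).trans_le (P.pairTime_le_streamTime i.2 m)
  have hbefore_long {t : ℝ} (ht : t ≤ P.streamTime P.N) (i : Fin P.k) :
      t ≤ P.streamTime P.N + (i : ℕ) := ht.trans (le_add_of_nonneg_right (Nat.cast_nonneg _))
  rcases x with ⟨i, b⟩ | m <;> rcases y with ⟨j, c⟩ | n <;>
    simp only [start, proc, Sum.elim_inl, Sum.elim_inr]
  · have hij : i = j → (b = σ i) ≠ (c = σ j) := by
      rintro rfl
      cases b <;> cases c <;> cases σ i <;> simp_all
    split_ifs with hb hc hc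
    · exact (lt_or_gt_of_ne fun h => hij (Fin.ext h) (by simp [hb, hc])).imp hshort hshort
    · exact .inl (hbefore_long (hshort_stream i _) j)
    · exact .inr (hbefore_long (hshort_stream j _) i)
    · exact (lt_or_gt_of_ne fun h => hij (Fin.ext h) (by simp [hb, hc])).imp hlong hlong
  · split_ifs
    · exact .inl (hshort_stream i n)
    · exact .inr (hbefore_long (hstream n.2) i)
  · split_ifs
    · exact .inr (hshort_stream j m)
    · exact .inl (hbefore_long (hstream m.2) j)
  · exact (lt_or_gt_of_ne fun h => hxy (congrArg _ (Fin.ext h))).imp hstream hstream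

theorem pairwise_disjoint_start :
    Pairwise (Function.onFun Disjoint
      fun x : P.Job => Ioc (P.start σ x) (P.start σ x + P.proc σ x)) :=
  fun _ _ hxy => (P.start_add_proc_le_start_or σ hxy).elim Ioc_disjoint_Ioc_of_le
    fun h => (Ioc_disjoint_Ioc_of_le h).symm

theorem sum_start_add_proc_sub_release_le (i : Fin P.k) :
    ∑ b, (P.start σ (.inl (i, b)) + P.proc σ (.inl (i, b)) - P.release (.inl (i, b))) ≤
      P.streamLength + P.k + 2 := by
  have hi : (i : ℝ) + 1 ≤ P.k := by exact_mod_cast i.2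
  simp only [sum_bool_eq_add_not _ (σ i), start, proc, release, Sum.elim_inl, if_pos,
    Bool.not_eq_self, if_neg, not_false_eq_true, streamTime, streamLength]
  linarith [P.shortSize_le_one i, P.pairTime_nonneg i, P.pairTime_le_one P.k]

theorem opt_inst_le :
    opt (P.inst σ) ≤
      ENNReal.ofReal (P.k * (P.streamLength + P.k + 2) + P.streamLength) := by
  refine (Instance.opt_ofIndexed_le _ _ _ (P.release_le_start σ)
    (P.pairwise_disjoint_start σ)).trans (ENNReal.ofReal_le_ofReal ?_)
  calc ∑ x : P.Job, (P.start σ x + P.proc σ x - P.release x)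
      = ∑ i, ∑ b, (P.start σ (.inl (i, b)) + P.proc σ (.inl (i, b)) - P.release (.inl (i, b))) +
          ∑ _m : Fin P.N, P.ε := by
        rw [Fintype.sum_sum_type, Fintype.sum_prod_type]
        simp [start, proc, release]
    _ ≤ ∑ _i : Fin P.k, (P.streamLength + P.k + 2) + ∑ _m : Fin P.N, P.ε :=
        add_le_add_left (Finset.sum_le_sum fun i _ =>
          P.sum_start_add_proc_sub_release_le σ i) _
    _ = P.k * (P.streamLength + P.k + 2) + P.streamLength := by
        simp only [Finset.sum_const, Finset.card_univ, Fintype.card_fin, nsmul_eq_mul,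
          streamLength]

end HardParams

/-! ### A lower bound for every schedule -/

namespace HardParams

variable (P : HardParams)

/-- The name of the element `b` of the pair `i` in the hard instances. -/
noncomputable def pairJob (i : Fin P.k) (b : Bool) : ℕ := Encodable.encode (.inl (i, b) : P.Job)

/-- The name of the stream job `m` in the hard instances. -/
noncomputable def streamJob (m : Fin P.N) : ℕ := Encodable.encode (.inr m : P.Job)

/-- The processing that a schedule gives to the jobs of the pairs during the stream. -/
noncomputable def pairWork (y : ℕ → ℝ → ℝ) : ℝ :=
  ∑ i, ∑ b, (y (P.pairJob i b) (P.streamTime P.N) - y (P.pairJob i b) (P.pairTime P.k))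

/-- A time until which, for small `β`, no job of the pair `i` can have emitted its signal, so that
the schedule cannot depend on which of them is the short one. -/
noncomputable def probeTime (i : ℕ) : ℝ := P.pairTime i + 2 * P.β ^ (i + 1)

/-- The pairs whose short job receives at most half of the machine between its release and the
probe time. Such a job remains unfinished during the whole stream, unless the jobs of the pairs
receive a substantial amount of processing meanwhile. -/
noncomputable def delayed (σ : Fin P.k → Bool) (y : ℕ → ℝ → ℝ) : Finset (Fin P.k) :=
  {i | y (P.pairJob i (σ i)) (P.probeTime i) ≤ P.β ^ ((i : ℕ) + 1)}

section JobNames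

variable (σ : Fin P.k → Bool) (i : Fin P.k) (b : Bool) (m : Fin P.N)

theorem pairJob_mem : P.pairJob i b ∈ (P.inst σ).jobs :=
  (Instance.mem_jobs_ofIndexed ..).2 ⟨_, rfl⟩

theorem streamJob_mem : P.streamJob m ∈ (P.inst σ).jobs :=
  (Instance.mem_jobs_ofIndexed ..).2 ⟨_, rfl⟩

theorem release_pairJob : (P.inst σ).release (P.pairJob i b) = P.pairTime i :=
  Instance.release_ofIndexed ..

theorem release_streamJob : (P.inst σ).release (P.streamJob m) = P.streamTime m :=
  Instance.release_ofIndexed ..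

theorem proc_pairJob :
    (P.inst σ).proc (P.pairJob i b) = if b = σ i then P.shortSize i else 1 :=
  Instance.proc_ofIndexed ..

theorem proc_streamJob : (P.inst σ).proc (P.streamJob m) = P.ε :=
  Instance.proc_ofIndexed ..

theorem sum_jobs {M : Type*} [AddCommMonoid M] (f : ℕ → M) :
    ∑ j ∈ (P.inst σ).jobs, f j =
      ∑ i, ∑ b, f (P.pairJob i b) + ∑ m, f (P.streamJob m) := by
  rw [inst, Instance.sum_jobs_ofIndexed, Fintype.sum_sum_type, Fintype.sum_prod_type]
  rfl

end JobNames

variable {P} {σ : Fin P.k → Bool} {y : ℕ → ℝ → ℝ}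

theorem pairWork_nonneg (hy : ∀ j, Monotone (y j)) : 0 ≤ P.pairWork y :=
  Finset.sum_nonneg fun _ _ => Finset.sum_nonneg fun _ _ =>
    sub_nonneg.2 (hy _ (P.pairTime_le_streamTime le_rfl _))

theorem half_pairWork_le_sum_unprocessed (hy : IsSchedule (P.inst σ) y) :
    P.pairWork y / 2 ≤
      ∑ m, (P.ε - y (P.streamJob m) (P.streamTime P.N + P.pairWork y / 2)) := by
  set v := P.streamTime P.N + P.pairWork y / 2
  have hend : P.streamTime P.N ≤ v :=
    le_add_of_nonneg_right (div_nonneg (pairWork_nonneg hy.mono) zero_le_two)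
  have hspeed : ∑ i, ∑ b, (y (P.pairJob i b) v - y (P.pairJob i b) (P.pairTime P.k)) +
      ∑ m, (y (P.streamJob m) v - y (P.streamJob m) (P.pairTime P.k)) ≤ v - P.pairTime P.k := by
    rw [← P.sum_jobs σ fun j => y j v - y j (P.pairTime P.k)]
    exact hy.speed _ _ ((P.pairTime_le_streamTime le_rfl _).trans hend)
  have hpairs : P.pairWork y ≤
      ∑ i, ∑ b, (y (P.pairJob i b) v - y (P.pairJob i b) (P.pairTime P.k)) :=
    Finset.sum_le_sum fun i _ => Finset.sum_le_sum fun b _ =>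
      sub_le_sub_right (hy.mono _ hend) _
  have hstream (m : Fin P.N) : y (P.streamJob m) (P.pairTime P.k) = 0 :=
    hy.before_release _ (P.streamJob_mem σ m) _
      ((P.pairTime_le_streamTime le_rfl m).trans_eq (P.release_streamJob σ m).symm)
  have hduration : v - P.pairTime P.k = P.N * P.ε + P.pairWork y / 2 := by
    simp only [v, streamTime]
    ring
  simp only [hstream, sub_zero] at hspeed
  rw [Finset.sum_sub_distrib, Finset.sum_const, Finset.card_univ, Fintype.card_fin, nsmul_eq_mul]
  linarith

theorem ofReal_pairWork_sq_div_le_sum_flowTime (hy : IsSchedule (P.inst σ) y) :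
    ENNReal.ofReal (P.pairWork y ^ 2 / (4 * P.ε)) ≤
      ∑ m, flowTime (P.inst σ) y (P.streamJob m) := by
  set v := P.streamTime P.N + P.pairWork y / 2
  have hW : 0 ≤ P.pairWork y / 2 := div_nonneg (pairWork_nonneg hy.mono) zero_le_two
  have hfraction (m : Fin P.N) : 0 ≤ P.pairWork y / 2 * ((P.ε - y (P.streamJob m) v) / P.ε) :=
    mul_nonneg hW (div_nonneg (sub_nonneg.2 (P.proc_streamJob σ m ▸
      hy.le_proc _ (P.streamJob_mem σ m) v)) P.ε_pos.le)
  calc ENNReal.ofReal (P.pairWork y ^ 2 / (4 * P.ε))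
      = ENNReal.ofReal (P.pairWork y / 2 * (P.pairWork y / 2 / P.ε)) := by
        congr 1
        ring
    _ ≤ ENNReal.ofReal (∑ m, P.pairWork y / 2 * ((P.ε - y (P.streamJob m) v) / P.ε)) := by
        rw [← Finset.mul_sum, ← Finset.sum_div]
        gcongr
        exacts [P.ε_pos.le, half_pairWork_le_sum_unprocessed hy]
    _ = ∑ m, ENNReal.ofReal (P.pairWork y / 2 * ((P.ε - y (P.streamJob m) v) / P.ε)) :=
        ENNReal.ofReal_sum_of_nonneg fun m _ => hfraction m
    _ ≤ ∑ m, flowTime (P.inst σ) y (P.streamJob m) := by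
        refine Finset.sum_le_sum fun m _ => ?_
        have hrelease : (P.inst σ).release (P.streamJob m) + P.pairWork y / 2 ≤ v := by
          rw [release_streamJob]
          exact add_le_add_left (P.streamTime_mono m.2.le) _
        simpa only [proc_streamJob] using
          hy.ofReal_mul_unprocessed_fraction_le_flowTime (P.streamJob_mem σ m) hW hrelease

theorem pairJob_sub_le_pairWork (hy : ∀ j, Monotone (y j)) (i : Fin P.k) (b : Bool) :
    y (P.pairJob i b) (P.streamTime P.N) - y (P.pairJob i b) (P.pairTime P.k) ≤ P.pairWork y := by
  have hterm (i : Fin P.k) (b : Bool) :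
      0 ≤ y (P.pairJob i b) (P.streamTime P.N) - y (P.pairJob i b) (P.pairTime P.k) :=
    sub_nonneg.2 (hy _ (P.pairTime_le_streamTime le_rfl _))
  exact (Finset.single_le_sum (fun b _ => hterm i b) (Finset.mem_univ b)).trans
    (Finset.single_le_sum (fun i _ => Finset.sum_nonneg fun b _ => hterm i b) (Finset.mem_univ i))

theorem lt_add_one_sub_of_pairWork_lt (hy : IsSchedule (P.inst σ) y)
    (hwork : P.pairWork y < P.β ^ P.k) (i : Fin P.k) (b : Bool) {s : ℝ}
    (hs : s ≤ P.pairTime P.k) :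
    y (P.pairJob i b) (P.streamTime P.N) < y (P.pairJob i b) s + (1 - s) := by
  have hbefore := hy.sub_le (P.pairJob_mem σ i b) hs
  linarith [pairJob_sub_le_pairWork hy.mono i b, P.one_sub_pairTime P.k]

theorem ofReal_streamLength_le_flowTime (hy : IsSchedule (P.inst σ) y) {i : Fin P.k} {b : Bool}
    (hunfinished : y (P.pairJob i b) (P.streamTime P.N) < (P.inst σ).proc (P.pairJob i b)) :
    ENNReal.ofReal P.streamLength ≤ flowTime (P.inst σ) y (P.pairJob i b) := by
  refine (ENNReal.ofReal_le_ofReal ?_).trans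
    (ofReal_le_flowTime (P.pairJob_mem σ i b) (hy.mono _) hunfinished)
  rw [release_pairJob, streamTime_N]
  linarith [P.pairTime_mono i.2.le]

theorem one_sub_probeTime (i : ℕ) : 1 - P.probeTime i = P.β ^ i - 2 * P.β ^ (i + 1) := by
  rw [probeTime, ← P.one_sub_pairTime i]
  ring

theorem probeTime_le_pairTime {i : ℕ} (hi : i < P.k) : P.probeTime i ≤ P.pairTime P.k := by
  refine le_trans ?_ (P.pairTime_mono hi)
  linarith [P.three_mul_β_pow_succ_le i, P.one_sub_probeTime i, P.one_sub_pairTime (i + 1)]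

theorem ofReal_streamLength_le_flowTime_long (hy : IsSchedule (P.inst σ) y)
    (hwork : P.pairWork y < P.β ^ P.k) (i : Fin P.k) :
    ENNReal.ofReal P.streamLength ≤ flowTime (P.inst σ) y (P.pairJob i (!σ i)) := by
  have hstart : y (P.pairJob i (!σ i)) (P.pairTime i) = 0 :=
    hy.before_release _ (P.pairJob_mem σ i _) _ (P.release_pairJob σ i _).ge
  have hlt := lt_add_one_sub_of_pairWork_lt hy hwork i (!σ i) (P.pairTime_mono i.2.le)
  refine ofReal_streamLength_le_flowTime hy ?_
  rw [proc_pairJob, if_neg (Bool.not_ne_self _)]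
  linarith [P.pairTime_nonneg i]

theorem ofReal_streamLength_le_flowTime_of_mem_delayed (hy : IsSchedule (P.inst σ) y)
    (hwork : P.pairWork y < P.β ^ P.k) {i : Fin P.k} (hi : i ∈ P.delayed σ y) :
    ENNReal.ofReal P.streamLength ≤ flowTime (P.inst σ) y (P.pairJob i (σ i)) := by
  have hdelayed : y (P.pairJob i (σ i)) (P.probeTime i) ≤ P.β ^ ((i : ℕ) + 1) :=
    (Finset.mem_filter.1 hi).2
  have hlt := lt_add_one_sub_of_pairWork_lt hy hwork i (σ i) (P.probeTime_le_pairTime i.2)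
  refine ofReal_streamLength_le_flowTime hy ?_
  rw [proc_pairJob, if_pos rfl, shortSize]
  linarith [P.one_sub_probeTime i]

theorem le_totalFlow (hy : IsSchedule (P.inst σ) y)
    (hε : 8 * P.k * P.streamLength * P.ε ≤ (P.β ^ P.k) ^ 2) :
    ENNReal.ofReal (P.streamLength * (P.k + (P.delayed σ y).card)) ≤ totalFlow (P.inst σ) y := by
  have htotal : totalFlow (P.inst σ) y =
      ∑ i, ∑ b, flowTime (P.inst σ) y (P.pairJob i b) +
        ∑ m, flowTime (P.inst σ) y (P.streamJob m) := P.sum_jobs σ (flowTime (P.inst σ) y)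
  rw [htotal]
  rcases le_or_gt (P.β ^ P.k) (P.pairWork y) with hwork | hwork
  · refine le_add_left ((ENNReal.ofReal_le_ofReal ?_).trans
      (ofReal_pairWork_sq_div_le_sum_flowTime hy))
    have hcard : ((P.delayed σ y).card : ℝ) ≤ P.k := by
      exact_mod_cast (card_finset_fin_le _)
    have hsq : (P.β ^ P.k) ^ 2 ≤ P.pairWork y ^ 2 := by
      gcongr
      exact (P.β_pow_pos _).le
    rw [le_div_iff₀ (mul_pos four_pos P.ε_pos)]
    calc P.streamLength * (P.k + (P.delayed σ y).card) * (4 * P.ε)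
        ≤ P.streamLength * (P.k + P.k) * (4 * P.ε) := by
          gcongr
          exacts [mul_nonneg zero_le_four P.ε_pos.le, P.streamLength_nonneg]
      _ = 8 * P.k * P.streamLength * P.ε := by ring
      _ ≤ P.pairWork y ^ 2 := hε.trans hsq
  · refine le_add_right ?_
    calc ENNReal.ofReal (P.streamLength * (P.k + (P.delayed σ y).card))
        = ∑ _i ∈ P.delayed σ y, ENNReal.ofReal P.streamLength +
            ∑ _i : Fin P.k, ENNReal.ofReal P.streamLength := by
          rw [Finset.sum_const, Finset.sum_const, Finset.card_univ, Fintype.card_fin, ← add_nsmul,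
            ← ENNReal.ofReal_nsmul, nsmul_eq_mul, Nat.cast_add, mul_comm, add_comm (P.k : ℝ)]
      _ ≤ ∑ i, flowTime (P.inst σ) y (P.pairJob i (σ i)) +
            ∑ i, flowTime (P.inst σ) y (P.pairJob i (!σ i)) :=
          add_le_add ((Finset.sum_le_sum fun i hi =>
            ofReal_streamLength_le_flowTime_of_mem_delayed hy hwork hi).trans
              (Finset.sum_le_univ_sum_of_nonneg fun _ => zero_le))
            (Finset.sum_le_sum fun i _ => ofReal_streamLength_le_flowTime_long hy hwork i)
      _ = ∑ i, ∑ b, flowTime (P.inst σ) y (P.pairJob i b) := by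
          rw [← Finset.sum_add_distrib]
          exact Finset.sum_congr rfl fun i _ =>
            (sum_bool_eq_add_not (fun b => flowTime (P.inst σ) y (P.pairJob i b)) (σ i)).symm

end HardParams

/-! ### Averaging over the hard instances -/

theorem card_le_two_mul_card_filter {X : Type*} [Fintype X] {p : X → Prop} [DecidablePred p]
    (φ : Equiv.Perm X) (h : ∀ x, p x ∨ p (φ x)) :
    Fintype.card X ≤ 2 * (Finset.univ.filter p).card := by
  classical
  have hcover : Finset.univ ⊆ Finset.univ.filter p ∪ Finset.univ.filter fun x => p (φ x) :=
    fun x _ => by simpa using h x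
  have hcard : (Finset.univ.filter fun x => p (φ x)).card = (Finset.univ.filter p).card :=
    Finset.card_equiv φ (by simp)
  calc Fintype.card X ≤ (Finset.univ.filter p).card + (Finset.univ.filter fun x => p (φ x)).card :=
        (Finset.card_le_card hcover).trans (Finset.card_union_le _ _)
    _ = 2 * (Finset.univ.filter p).card := by rw [hcard, two_mul]

namespace HardParams

variable {P : HardParams} {σ σ' : Fin P.k → Bool} {i : Fin P.k}

theorem add_not_at_probeTime_le {y : ℕ → ℝ → ℝ} (hy : IsSchedule (P.inst σ) y) (b : Bool) :
    y (P.pairJob i b) (P.probeTime i) + y (P.pairJob i (!b)) (P.probeTime i) ≤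
      2 * P.β ^ ((i : ℕ) + 1) := by
  have hne : P.pairJob i b ≠ P.pairJob i (!b) := by simp [pairJob]
  have hpair : {P.pairJob i b, P.pairJob i (!b)} ⊆ (P.inst σ).jobs :=
    Finset.insert_subset (P.pairJob_mem σ i b)
      (Finset.singleton_subset_iff.2 (P.pairJob_mem σ i (!b)))
  have hle : P.pairTime i ≤ P.probeTime i :=
    le_add_of_nonneg_right (mul_nonneg zero_le_two (P.β_pow_pos _).le)
  have hrelease (c : Bool) : y (P.pairJob i c) (P.pairTime i) = 0 :=
    hy.before_release _ (P.pairJob_mem σ i c) _ (P.release_pairJob σ i c).ge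
  have hspeed := hy.sum_sub_le_of_subset hpair hle
  rwa [Finset.sum_pair hne, hrelease, hrelease, sub_zero, sub_zero, probeTime,
    add_sub_cancel_left] at hspeed

theorem two_mul_β_pow_succ_le_mul_proc (hα : 0 < α) (hβ : 2 * P.β ≤ α * (1 - P.β)) (b : Bool) :
    2 * P.β ^ ((i : ℕ) + 1) ≤ α * (P.inst σ).proc (P.pairJob i b) := by
  have hshort : P.shortSize i ≤ (P.inst σ).proc (P.pairJob i b) := by
    rw [proc_pairJob]
    split_ifs
    exacts [le_rfl, P.shortSize_le_one i]
  calc 2 * P.β ^ ((i : ℕ) + 1) = 2 * P.β * P.β ^ (i : ℕ) := by ring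
    _ ≤ α * (1 - P.β) * P.β ^ (i : ℕ) := by
      gcongr
      exact (P.β_pow_pos _).le
    _ = α * P.shortSize i := by
      rw [shortSize]
      ring
    _ ≤ α * (P.inst σ).proc (P.pairJob i b) := by gcongr

theorem lt_mul_proc_of_lt_probeTime (hα : 0 < α) (hβ : 2 * P.β ≤ α * (1 - P.β))
    {y : ℕ → ℝ → ℝ} (hy : IsSchedule (P.inst σ) y) (b : Bool) {u : ℝ} (hu : u < P.probeTime i) :
    y (P.pairJob i b) u < α * (P.inst σ).proc (P.pairJob i b) :=
  (hy.lt_of_lt_release_add (P.pairJob_mem σ i b) (mul_pos two_pos (P.β_pow_pos _))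
    (by rwa [release_pairJob])).trans_le (two_mul_β_pow_succ_le_mul_proc hα hβ b)

theorem exists_eq_pairJob_of_proc_ne (hσ : ∀ j ≠ i, σ j = σ' j) {n : ℕ}
    (hn : n ∈ (P.inst σ).jobs) (hne : (P.inst σ).proc n ≠ (P.inst σ').proc n) :
    ∃ b, n = P.pairJob i b := by
  obtain ⟨⟨j, b⟩ | m, rfl⟩ := (Instance.mem_jobs_ofIndexed ..).1 hn
  · rcases eq_or_ne j i with rfl | hj
    · exact ⟨b, rfl⟩
    · refine absurd ?_ hne
      change (P.inst σ).proc (P.pairJob j b) = (P.inst σ').proc (P.pairJob j b)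
      rw [proc_pairJob, proc_pairJob, hσ j hj]
  · exact absurd ((P.proc_streamJob σ m).trans (P.proc_streamJob σ' m).symm) hne

theorem sched_eq_of_le_probeTime (hα : 0 < α) (hβ : 2 * P.β ≤ α * (1 - P.β))
    (D : DetAlgorithm α) (hσ : ∀ j ≠ i, σ j = σ' j) :
    ∀ n, ∀ u ≤ P.probeTime i, D.sched (P.inst σ) n u = D.sched (P.inst σ') n u := by
  refine D.sched_eq_of_no_signal rfl rfl fun n hn hne u hu => ?_
  obtain ⟨b, rfl⟩ := exists_eq_pairJob_of_proc_ne hσ hn hne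
  exact ⟨lt_mul_proc_of_lt_probeTime hα hβ (D.feasible _) b hu,
    lt_mul_proc_of_lt_probeTime hα hβ (D.feasible _) b hu⟩

theorem mem_delayed_or_mem_delayed (hα : 0 < α) (hβ : 2 * P.β ≤ α * (1 - P.β))
    (D : DetAlgorithm α) (hσ : ∀ j ≠ i, σ j = σ' j) (hi : σ' i = !σ i) :
    i ∈ P.delayed σ (D.sched (P.inst σ)) ∨ i ∈ P.delayed σ' (D.sched (P.inst σ')) := by
  have hsum := add_not_at_probeTime_le (i := i) (D.feasible (P.inst σ)) (σ i)
  simp only [delayed, Finset.mem_filter, Finset.mem_univ, true_and, hi,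
    ← sched_eq_of_le_probeTime hα hβ D hσ _ _ le_rfl]
  by_contra! h
  linarith [h.1, h.2]

theorem two_pow_le_two_mul_card_mem_delayed (hα : 0 < α) (hβ : 2 * P.β ≤ α * (1 - P.β))
    (D : DetAlgorithm α) (i : Fin P.k) :
    2 ^ P.k ≤
      2 * (Finset.univ.filter fun σ => i ∈ P.delayed σ (D.sched (P.inst σ))).card := by
  have hflip : Function.Involutive fun σ : Fin P.k → Bool => Function.update σ i (!σ i) :=
    fun σ => by simp
  simpa using card_le_two_mul_card_filter (hflip.toPerm _) fun σ =>
    mem_delayed_or_mem_delayed hα hβ D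
      (fun j hj => (Function.update_of_ne hj (!σ i) σ).symm) (Function.update_self i (!σ i) σ)

theorem mul_two_pow_le_two_mul_sum_card_delayed (hα : 0 < α) (hβ : 2 * P.β ≤ α * (1 - P.β))
    (D : DetAlgorithm α) :
    P.k * 2 ^ P.k ≤ 2 * ∑ σ, (P.delayed σ (D.sched (P.inst σ))).card := by
  have hcount := Finset.sum_card_bipartiteAbove_eq_sum_card_bipartiteBelow
    (s := (Finset.univ : Finset (Fin P.k → Bool))) (t := Finset.univ)
    fun σ i => i ∈ P.delayed σ (D.sched (P.inst σ))
  simp only [Finset.bipartiteAbove, Finset.bipartiteBelow, Finset.filter_univ_mem] at hcount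
  rw [hcount, Finset.mul_sum]
  calc P.k * 2 ^ P.k = ∑ _i : Fin P.k, 2 ^ P.k := by simp
    _ ≤ ∑ i, 2 * (Finset.univ.filter fun σ => i ∈ P.delayed σ (D.sched (P.inst σ))).card :=
      Finset.sum_le_sum fun i _ => two_pow_le_two_mul_card_mem_delayed hα hβ D i

theorem le_sum_totalFlow (hα : 0 < α) (hβ : 2 * P.β ≤ α * (1 - P.β))
    (hε : 8 * P.k * P.streamLength * P.ε ≤ (P.β ^ P.k) ^ 2) (D : DetAlgorithm α) :
    ENNReal.ofReal (P.streamLength * (3 / 2 * P.k * 2 ^ P.k)) ≤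
      ∑ σ, totalFlow (P.inst σ) (D.sched (P.inst σ)) := by
  have hdelayed : (P.k * 2 ^ P.k : ℝ) ≤ 
      2 * ∑ σ, ((P.delayed σ (D.sched (P.inst σ))).card : ℝ) := by
    exact_mod_cast mul_two_pow_le_two_mul_sum_card_delayed hα hβ D
  calc ENNReal.ofReal (P.streamLength * (3 / 2 * P.k * 2 ^ P.k))
      ≤ ENNReal.ofReal
          (∑ σ, P.streamLength * (P.k + (P.delayed σ (D.sched (P.inst σ))).card)) := by
        rw [← Finset.mul_sum, Finset.sum_add_distrib]
        gcongr
        · exact P.streamLength_nonneg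
        · rw [Finset.sum_const, Finset.card_univ, Fintype.card_fun, Fintype.card_fin,
            Fintype.card_bool, nsmul_eq_mul]
          push_cast
          linarith
    _ = ∑ σ, ENNReal.ofReal (P.streamLength * (P.k + (P.delayed σ (D.sched (P.inst σ))).card)) :=
        ENNReal.ofReal_sum_of_nonneg fun σ _ => mul_nonneg P.streamLength_nonneg (by positivity)
    _ ≤ ∑ σ, totalFlow (P.inst σ) (D.sched (P.inst σ)) :=
        Finset.sum_le_sum fun σ _ => le_totalFlow (D.feasible _) hε

-- For streams of this length, the term `k * (k + 2)` of `opt_inst_le` is of lower order in `k` than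
-- the main term `k * streamLength`.
theorem exists_params (hα : 0 < α) (k : ℕ) :
    ∃ P : HardParams, P.k = k ∧ P.streamLength = (k + 1) ^ 2 ∧ 2 * P.β ≤ α * (1 - P.β) ∧
      8 * P.k * P.streamLength * P.ε ≤ (P.β ^ P.k) ^ 2 := by
  set β : ℝ := min α 1 / 4
  have hβ_pos : 0 < β := div_pos (lt_min hα one_pos) four_pos
  have hβ_one : β ≤ 1 / 4 := div_le_div_of_nonneg_right (min_le_right α 1) zero_le_four
  have hβ_α : 4 * β ≤ α := (mul_div_cancel₀ _ four_ne_zero).trans_le (min_le_left α 1)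
  obtain ⟨N, hN⟩ := exists_nat_gt (8 * k * (k + 1) ^ 4 / (β ^ k) ^ 2)
  have hN_pos : (0 : ℝ) < N := lt_of_le_of_lt (by positivity) hN
  refine ⟨⟨β, (k + 1) ^ 2 / N, k, N, hβ_pos, by linarith, by positivity⟩, rfl, ?_, ?_, ?_⟩
  · exact mul_div_cancel₀ _ hN_pos.ne'
  · change 2 * β ≤ α * (1 - β)
    nlinarith
  · simp only [streamLength]
    rw [div_lt_iff₀ (by positivity)] at hN
    rw [mul_div_cancel₀ _ hN_pos.ne', mul_div_assoc', div_le_iff₀ hN_pos]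
    linarith

end HardParams

theorem RandAlgorithm.IsCompetitive.three_halves_mul_le {A : RandAlgorithm α} {c : NNReal}
    (hA : A.IsCompetitive c) (hα : 0 < α) (k : ℕ) : 3 / 2 * (k : ℝ) ≤ c * (k + 2) := by
  obtain ⟨P, rfl, hlength, hβ, hε⟩ := HardParams.exists_params hα k
  have hlength_pos : 0 < P.streamLength := by
    rw [hlength]
    positivity
  have hopt (σ : Fin P.k → Bool) :
      opt (P.inst σ) ≤ ENNReal.ofReal (P.streamLength * (P.k + 2)) := by
    refine (P.opt_inst_le σ).trans (ENNReal.ofReal_le_ofReal ?_)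
    rw [hlength]
    linarith
  have hofReal : ENNReal.ofReal (P.streamLength * (3 / 2 * P.k * 2 ^ P.k)) ≤
      ENNReal.ofReal (c * (2 ^ P.k * (P.streamLength * (P.k + 2)))) :=
    calc _ ≤ c * ∑ σ, opt (P.inst σ) :=
          hA.le_mul_sum_opt Finset.univ P.inst (HardParams.le_sum_totalFlow hα hβ hε)
      _ ≤ c * ∑ _σ : Fin P.k → Bool, ENNReal.ofReal (P.streamLength * (P.k + 2)) := by
          gcongr with σ
          exact hopt σ
      _ = _ := by
          rw [ENNReal.ofReal_mul c.coe_nonneg, ENNReal.ofReal_coe_nnreal,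
            ENNReal.ofReal_mul (by positivity : (0 : ℝ) ≤ 2 ^ P.k)]
          simp [ENNReal.ofReal_pow]
  have hreal := (ENNReal.ofReal_le_ofReal_iff (by positivity)).1 hofReal
  have hscale : (0 : ℝ) < P.streamLength * 2 ^ P.k := by positivity
  refine le_of_mul_le_mul_left ?_ hscale
  linarith

theorem le_of_forall_nat_mul_le_mul_add {K : Type*} [Field K] [LinearOrder K]
    [IsStrictOrderedRing K] [Archimedean K] {a c d : K} (h : ∀ k : ℕ, a * k ≤ c * (k + d)) :
    a ≤ c := by
  by_contra! hlt
  obtain ⟨k, hk⟩ := exists_nat_gt (c * d / (a - c))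
  rw [div_lt_iff₀ (sub_pos.2 hlt)] at hk
  linarith [h k]

end FlowTime

theorem mainTheorem8_general (α : ℝ) (hα : 0 < α) (A : FlowTime.RandAlgorithm α) :
    3 / 2 ≤ A.competitiveRatio := by
  refine le_sInf fun c hA => ?_
  induction c with
  | top => exact le_top
  | coe c =>
    have hc : (3 / 2 : ℝ) ≤ c :=
      FlowTime.le_of_forall_nat_mul_le_mul_add (hA.three_halves_mul_le hα)
    rw [ENNReal.div_le_iff two_ne_zero ENNReal.ofNat_ne_top]
    exact_mod_cast (div_le_iff₀ two_pos).1 hc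

theorem mainTheorem8 (α : ℝ) (hα0 : 0 < α) (hα1 : α < 1) (A : FlowTime.RandAlgorithm α) :
    3 / 2 ≤ A.competitiveRatio :=
  mainTheorem8_general α hα0 A
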